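/- Let $\Omega\subseteq\mathbb{R}^d$ be a set on which derivatives within $\Omega$ are unique (for example an open set, or the closure of a bounded open set with smooth boundary), let $m\ge 0$, and let $\mathcal{D}=\sum_{j\le m}\sum_{i_1,\dots,i_j} c_{i_1\dots i_j}(x)\,\partial_{i_1}\cdots\partial_{i_j}$ be a linear differential operator of order at most $m$ with arbitrary real coefficient functions. Let $F$ be a separable Banach space of real-valued functions on $\Omega$ that are $m$ times continuously differentiable on $\Omega$, with continuous point evaluations. Let $k_x:\Omega\times\Omega\to\mathbb{R}$, $\gamma>0$, and let $\mathbb{X}=(x_0,\dots,x_N)$ be points of $\Omega$ such that the matrix $k_x(\mathbb{X},\mathbb{X})=(k_x(x_i,x_j))_{i,j}$ is invertible. Write $\mathcal{D}k_x$, $\mathcal{D}^*k_x$ for $\mathcal{D}$ applied to the first, respectively second, argument of $k_x$, and put $$W(z)=(\mathcal{D}k_x)(z,\mathbb{X})\,k_x(\mathbb{X},\mathbb{X})^{-1},\qquad \hat k(z,z')=(\mathcal{D}\mathcal{D}^*k_x)(z,z')-W(z)\,k_x(\mathbb{X},\mathbb{X})\,W(z')^\top,$$ $$D=(\mathcal{D}k_x)(\mathbb{X},\mathbb{X})\,k_x(\mathbb{X},\mathbb{X})^{-1},\qquad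 E=(\mathcal{D}\mathcal{D}^*k_x)(\mathbb{X},\mathbb{X})-D\,k_x(\mathbb{X},\mathbb{X})\,D^\top .$$ A probabilistic numerical method consists of an information operator $A$ on $F$ and a belief update $B$, which maps a prior $\mu$ and a datum $a$ to a measure. A disintegration of $\mu$ with respect to $A$ is a family of probability measures $\mu^a$ on $F$, measurable in $a$, such that $\mu^a(\{A\ne a\})=0$ for $A_\#\mu$-almost every $a$ and $\int f\,d\mu=\int\!\int f\,d\mu^a\,(A_\#\mu)(da)$ for all measurable $f\ge 0$. The method is Bayesian for a quantity of interest $Q$ (in the sense of Cockayne et al., 2019) if, for its priors $\mu$, a disintegration exists and, for every disintegration, $B(\mu,a)=Q_\#\mu^a$ for $A_\#\mu$-almost every $a$. **Proposition.** Consider as prior a probability measure $\mu$ on $F$ that is the law of the Gaussian process $\mathcal{GP}(0,\gamma^2k_x)$, that is, under which the evaluations $(u(z))_{z\in\Omega}$ form a centred Gaussian process with covariance $\gamma^2k_x$. Then the method with information operator $A(u)=u(\mathbb{X})$ and belief update $B(\mu,a)=\mathcal{N}(Da,\gamma^2E)$ is Bayesian for the quantity of interest $Q(u)=(\mathcal{D}u)(\mathbb{X})$.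 Moreover $E$ is positive semidefinite, and for every disintegration $(\mu^a)$ of $\mu$ with respect to $A$ and $A_\#\mu$-almost every $a$, the process $((\mathcal{D}u)(z))_{z\in\Omega}$ is, under $\mu^a$, a Gaussian process with mean $z\mapsto W(z)a$ and covariance $\gamma^2\hat k$. -/

import Mathlib

open MeasureTheory ProbabilityTheory

/-! ### Linear differential operators -/

/-- A linear partial differential operator of order at most `m` on (a subset of) `ℝᵈ`, with
arbitrary real coefficient functions:
`∑_{j ≤ m} ∑_{i₁, …, i_j} coeff j (i₁, …, i_j) (x) ∂_{i₁} ⋯ ∂_{i_j}`. -/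
structure LinDiffOp (d m : ℕ) where
  coeff : (j : Fin (m + 1)) → (Fin j → Fin d) → EuclideanSpace ℝ (Fin d) → ℝ

namespace LinDiffOp

variable {d m : ℕ}

/-- The value `(𝒟 f)(x)`, with partial derivatives taken within `Ω` (the usual partial derivatives
if `Ω` is open, one-sided ones at the boundary points that belong to `Ω`). -/
noncomputable def app (𝒟 : LinDiffOp d m) (Ω : Set (EuclideanSpace ℝ (Fin d)))
    (f : EuclideanSpace ℝ (Fin d) → ℝ) (x : EuclideanSpace ℝ (Fin d)) : ℝ :=
  ∑ j : Fin (m + 1), ∑ I : Fin j → Fin d,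
    𝒟.coeff j I x *
      iteratedFDerivWithin ℝ j f Ω x (fun l => EuclideanSpace.single (I l) (1 : ℝ))

/-- `(𝒟 k)(z, z')`: the operator acts on the first argument of the kernel. -/
noncomputable def kerFst (𝒟 : LinDiffOp d m) (Ω : Set (EuclideanSpace ℝ (Fin d)))
    (k : EuclideanSpace ℝ (Fin d) → EuclideanSpace ℝ (Fin d) → ℝ)
    (z z' : EuclideanSpace ℝ (Fin d)) : ℝ :=
  𝒟.app Ω (fun y => k y z') z

/-- `(𝒟* k)(z, z')`: the operator acts on the second argument of the kernel. -/
noncomputable def kerSnd (𝒟 : LinDiffOp d m) (Ω : Set (EuclideanSpace ℝ (Fin d)))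
    (k : EuclideanSpace ℝ (Fin d) → EuclideanSpace ℝ (Fin d) → ℝ)
    (z z' : EuclideanSpace ℝ (Fin d)) : ℝ :=
  𝒟.app Ω (fun y => k z y) z'

/-- `(𝒟 𝒟* k)(z, z')`. -/
noncomputable def kerBoth (𝒟 : LinDiffOp d m) (Ω : Set (EuclideanSpace ℝ (Fin d)))
    (k : EuclideanSpace ℝ (Fin d) → EuclideanSpace ℝ (Fin d) → ℝ) :
    EuclideanSpace ℝ (Fin d) → EuclideanSpace ℝ (Fin d) → ℝ :=
  𝒟.kerFst Ω (𝒟.kerSnd Ω k)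

end LinDiffOp

/-! ### Banach spaces of differentiable functions -/

/-- Realisation of a normed space `F` as a space of `m` times continuously differentiable
real-valued functions on `Ω ⊆ ℝᵈ`, with continuous point evaluations. An element of `F` is
determined by the restriction to `Ω` of the function it represents; values off `Ω` play no role. -/
structure SmoothFunctionSpace {d : ℕ} (Ω : Set (EuclideanSpace ℝ (Fin d))) (m : ℕ)
    (F : Type*) [NormedAddCommGroup F] [NormedSpace ℝ F] where
  toFun : F →ₗ[ℝ] (EuclideanSpace ℝ (Fin d) → ℝ)
  injective_on : ∀ f g : F, (∀ x ∈ Ω, toFun f x = toFun g x) → f = g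
  continuous_eval : ∀ x ∈ Ω, Continuous (fun f : F => toFun f x)
  contDiffOn : ∀ f : F, ContDiffOn ℝ m (toFun f) Ω

/-! ### Gaussian processes with given moments -/

/-- Under `P`, the real-valued process `Y` is a Gaussian process `GP(mean, c)`. -/
def IsGPWith {T Ω' : Type*} [MeasurableSpace Ω'] (Y : T → Ω' → ℝ)
    (mean : T → ℝ) (c : T → T → ℝ) (P : Measure Ω') : Prop :=
  IsGaussianProcess Y P ∧ (∀ t, ∫ ω, Y t ω ∂P = mean t) ∧
    ∀ s t, covariance (Y s) (Y t) P = c s t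

/-- The measure `μ` on the function space `F` is the Gaussian process law `GP(0, k)` on `Ω`. -/
def IsGPPrior {d m : ℕ} {Ω : Set (EuclideanSpace ℝ (Fin d))} {F : Type*}
    [NormedAddCommGroup F] [NormedSpace ℝ F] [MeasurableSpace F]
    (S : SmoothFunctionSpace Ω m F)
    (k : EuclideanSpace ℝ (Fin d) → EuclideanSpace ℝ (Fin d) → ℝ) (μ : Measure F) : Prop :=
  IsGPWith (fun (z : Ω) (f : F) => S.toFun f z) (fun _ => 0) (fun z z' => k z z') μ

/-! ### Bayesian probabilistic numerical methods -/

/-- The family of probability measures `(κ a)` is a disintegration of `μ` with respect to `A`: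
`κ a` is concentrated on the fibre `{A = a}` for almost every `a`, and `μ` is recovered by
averaging. Measurability of `a ↦ ∫ f d(κ a)` is part of `κ` being a kernel. -/
structure IsDisintegration {𝒳 𝒜 : Type*} [MeasurableSpace 𝒳] [MeasurableSpace 𝒜]
    (κ : Kernel 𝒜 𝒳) (μ : Measure 𝒳) (A : 𝒳 → 𝒜) : Prop where
  isMarkov : IsMarkovKernel κ
  concentrated : ∀ᵐ a ∂(μ.map A), κ a {x | A x ≠ a} = 0
  lintegral_eq : ∀ f : 𝒳 → ENNReal, Measurable f →
    ∫⁻ x, f x ∂μ = ∫⁻ a, (∫⁻ x, f x ∂(κ a)) ∂(μ.map A)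

/-- A probabilistic numerical method: an information operator and a belief update operator, which
maps a prior and an observed value of the information operator to a measure on the space of the
quantity of interest. `priors` is the set of priors for which the method is meant. -/
structure PNMethod (𝒳 𝒜 𝒬 : Type*) [MeasurableSpace 𝒳] [MeasurableSpace 𝒜]
    [MeasurableSpace 𝒬] where
  priors : Set (Measure 𝒳)
  info : 𝒳 → 𝒜
  update : Measure 𝒳 → 𝒜 → Measure 𝒬

/-- The method is Bayesian for the quantity of interest `Q`: for each of its priors `μ`,
a disintegration of `μ` with respect to the information operator exists, and for every such
disintegration the output is, for almost every datum `a`, the pushforward through `Q` of the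
conditional distribution given `a`. -/
def PNMethod.IsBayesian {𝒳 𝒜 𝒬 : Type*} [MeasurableSpace 𝒳] [MeasurableSpace 𝒜]
    [MeasurableSpace 𝒬] (M : PNMethod 𝒳 𝒜 𝒬) (Q : 𝒳 → 𝒬) : Prop :=
  ∀ μ ∈ M.priors, (∃ κ : Kernel 𝒜 𝒳, IsDisintegration κ μ M.info) ∧
    ∀ κ : Kernel 𝒜 𝒳, IsDisintegration κ μ M.info →
      ∀ᵐ a ∂(μ.map M.info), M.update μ a = (κ a).map Q

/-! ### The probabilistic discretisation -/

namespace Discretisation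

variable {d m N : ℕ}

/-- The matrix `k(𝕏, 𝕏)`. -/
def kerMatrix (k : EuclideanSpace ℝ (Fin d) → EuclideanSpace ℝ (Fin d) → ℝ)
    (X : Fin (N + 1) → EuclideanSpace ℝ (Fin d)) : Matrix (Fin (N + 1)) (Fin (N + 1)) ℝ :=
  Matrix.of fun i j => k (X i) (X j)

/-- The differentiation matrix `D = (𝒟 k)(𝕏, 𝕏) k(𝕏, 𝕏)⁻¹`. -/
noncomputable def diffMatrix (𝒟 : LinDiffOp d m) (Ω : Set (EuclideanSpace ℝ (Fin d)))
    (k : EuclideanSpace ℝ (Fin d) → EuclideanSpace ℝ (Fin d) → ℝ)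
    (X : Fin (N + 1) → EuclideanSpace ℝ (Fin d)) : Matrix (Fin (N + 1)) (Fin (N + 1)) ℝ :=
  kerMatrix (𝒟.kerFst Ω k) X * (kerMatrix k X)⁻¹

/-- The error covariance `E = (𝒟 𝒟* k)(𝕏, 𝕏) - D k(𝕏, 𝕏) Dᵀ`. -/
noncomputable def errMatrix (𝒟 : LinDiffOp d m) (Ω : Set (EuclideanSpace ℝ (Fin d)))
    (k : EuclideanSpace ℝ (Fin d) → EuclideanSpace ℝ (Fin d) → ℝ)
    (X : Fin (N + 1) → EuclideanSpace ℝ (Fin d)) : Matrix (Fin (N + 1)) (Fin (N + 1)) ℝ :=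
  kerMatrix (𝒟.kerBoth Ω k) X
    - diffMatrix 𝒟 Ω k X * kerMatrix k X * (diffMatrix 𝒟 Ω k X).transpose

/-- The row vector `W(z) = (𝒟 k)(z, 𝕏) k(𝕏, 𝕏)⁻¹`. -/
noncomputable def weight (𝒟 : LinDiffOp d m) (Ω : Set (EuclideanSpace ℝ (Fin d)))
    (k : EuclideanSpace ℝ (Fin d) → EuclideanSpace ℝ (Fin d) → ℝ)
    (X : Fin (N + 1) → EuclideanSpace ℝ (Fin d)) (z : EuclideanSpace ℝ (Fin d)) :
    Fin (N + 1) → ℝ :=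
  Matrix.vecMul (fun i => 𝒟.kerFst Ω k z (X i)) (kerMatrix k X)⁻¹

/-- The kernel `k̂(z, z') = (𝒟 𝒟* k)(z, z') - W(z) k(𝕏, 𝕏) W(z')ᵀ`. -/
noncomputable def errKernel (𝒟 : LinDiffOp d m) (Ω : Set (EuclideanSpace ℝ (Fin d)))
    (k : EuclideanSpace ℝ (Fin d) → EuclideanSpace ℝ (Fin d) → ℝ)
    (X : Fin (N + 1) → EuclideanSpace ℝ (Fin d)) (z z' : EuclideanSpace ℝ (Fin d)) : ℝ :=
  𝒟.kerBoth Ω k z z'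
    - dotProduct (weight 𝒟 Ω k X z) (Matrix.mulVec (kerMatrix k X) (weight 𝒟 Ω k X z'))

theorem diffMatrix_apply (𝒟 : LinDiffOp d m) (Ω : Set (EuclideanSpace ℝ (Fin d)))
    (k : EuclideanSpace ℝ (Fin d) → EuclideanSpace ℝ (Fin d) → ℝ)
    (X : Fin (N + 1) → EuclideanSpace ℝ (Fin d)) (i j : Fin (N + 1)) :
    diffMatrix 𝒟 Ω k X i j = weight 𝒟 Ω k X (X i) j := rfl

theorem errMatrix_apply (𝒟 : LinDiffOp d m) (Ω : Set (EuclideanSpace ℝ (Fin d)))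
    (k : EuclideanSpace ℝ (Fin d) → EuclideanSpace ℝ (Fin d) → ℝ)
    (X : Fin (N + 1) → EuclideanSpace ℝ (Fin d)) (i j : Fin (N + 1)) :
    errMatrix 𝒟 Ω k X i j = errKernel 𝒟 Ω k X (X i) (X j) := by
  rw [errMatrix, errKernel, Matrix.mul_assoc]
  rfl

variable {Ω : Set (EuclideanSpace ℝ (Fin d))} {F : Type*} [NormedAddCommGroup F]
  [NormedSpace ℝ F] [MeasurableSpace F]

/-- The quantity of interest `u ↦ (𝒟 u)(𝕏)`. -/
noncomputable def qoi (S : SmoothFunctionSpace Ω m F) (𝒟 : LinDiffOp d m)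
    (X : Fin (N + 1) → EuclideanSpace ℝ (Fin d)) (u : F) : EuclideanSpace ℝ (Fin (N + 1)) :=
  WithLp.toLp 2 fun i => 𝒟.app Ω (S.toFun u) (X i)

/-- The probabilistic discretisation of `𝒟` on the grid `𝕏`: for the prior `GP(0, γ² k)` and grid
values `a = u(𝕏)` it returns `𝒩(D a, γ² E)`. -/
noncomputable def method (S : SmoothFunctionSpace Ω m F) (𝒟 : LinDiffOp d m)
    (k : EuclideanSpace ℝ (Fin d) → EuclideanSpace ℝ (Fin d) → ℝ) (γ : ℝ)
    (X : Fin (N + 1) → EuclideanSpace ℝ (Fin d)) :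
    PNMethod F (Fin (N + 1) → ℝ) (EuclideanSpace ℝ (Fin (N + 1))) where
  priors := {μ | IsGPPrior S (fun z z' => γ ^ 2 * k z z') μ}
  info := fun u i => S.toFun u (X i)
  update := fun _ a => multivariateGaussian
    (WithLp.toLp 2 (Matrix.mulVec (diffMatrix 𝒟 Ω k X) a)) (γ ^ 2 • errMatrix 𝒟 Ω k X)

end Discretisation

/-!
The proof conditions a Gaussian process through the residual of its regression on the grid values.

*Derivatives stay Gaussian.* Under the prior, the functionals on `F` whose class lies in the closed
linear span of the point evaluations in `L²(μ)` form a space `gaussianSpace` of jointly Gaussian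
centred variables. On it, pointwise convergence implies convergence in `L²`, since the variance of a
centred Gaussian variable is determined by its characteristic function
(`tendsto_integral_sq_of_mem_gaussianSpace`). Hence the space is closed under pointwise limits of
sequences (`isSeqClosed_gaussianSpace`). A derivative within `Ω` in a tangent direction is a limit
of difference quotients, and tangent directions span the whole space where derivatives are unique;
so `u ↦ (𝒟 u)(z)` lies in the Gaussian space (`LinDiffOp.app_mem_of_isSeqClosed`). The same
implication from pointwise to `L²` convergence makes `y ↦ u(y)` differentiable in `L²`, so that `𝒟`
may be applied under the integral sign (`LinDiffOp.app_integral`). This identifies `γ² 𝒟 k` and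
`γ² 𝒟 𝒟* k` as covariances.

*Conditioning.* The residual `(R u)(y) = u(y) - k(y, 𝕏) k(𝕏, 𝕏)⁻¹ u(𝕏)` is uncorrelated with
`u(𝕏)`, hence independent of it, and `(𝒟 u)(z) = (𝒟 R u)(z) + W(z) u(𝕏)`. Under the prior, `𝒟 R u`
is a centred Gaussian process with covariance `γ² k̂` (`Discretisation.isGPWith_app_residual`).
For almost every `a`, the residual on a countable dense subset of `Ω` has the same law under `μ^a`
as under `μ` (`IsDisintegration.map_eq_of_indepFun`). All variables `(𝒟 R u)(z)` are measurable
functions of these countably many values, again by closedness under pointwise limits, now for the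
space of measurable functions. So a single null set of data suffices for all `z ∈ Ω`, although `Ω`
is uncountable and the coefficients of `𝒟` are arbitrary. As `u(𝕏) = a` holds `μ^a`-almost surely,
the law of `𝒟 u` under `μ^a` is that of `𝒟 R u` shifted by `W(·) a`.
-/

open Filter Topology

/-! ### Derivatives of families of functions -/

section Derivatives

variable {α E : Type*} [NormedAddCommGroup E] [NormedSpace ℝ E] {s : Set E} {x : E}

/-- Recursion for iterated derivatives of real-valued functions that only involves real-valued
functions: the last direction is differentiated first. -/
lemma iteratedFDerivWithin_succ_apply_eq_fderivWithin_apply {n : ℕ} {f : E → ℝ}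
    (hs : UniqueDiffOn ℝ s) (hf : ContDiffOn ℝ (n + 1) f s) (hx : x ∈ s) (v : Fin (n + 1) → E) :
    iteratedFDerivWithin ℝ (n + 1) f s x v =
      iteratedFDerivWithin ℝ n (fun y => fderivWithin ℝ f s y (v (Fin.last n))) s x
        (Fin.init v) := by
  have h := ((contDiffOn_succ_iff_fderivWithin hs).1 hf).2.2
  rw [iteratedFDerivWithin_succ_apply_right hs hx]
  have := ContinuousLinearMap.iteratedFDerivWithin_comp_left (i := n)
    (ContinuousLinearMap.apply ℝ ℝ (v (Fin.last n))) (h x hx) hs hx le_rfl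
  have h2 : (fun y => fderivWithin ℝ f s y (v (Fin.last n))) =
    ⇑(ContinuousLinearMap.apply ℝ ℝ (v (Fin.last n))) ∘ fderivWithin ℝ f s := rfl
  rw [h2, this]
  rfl

lemma ContDiffOn.fderivWithin_apply_const {n : ℕ} {f : E → ℝ} (hs : UniqueDiffOn ℝ s)
    (hf : ContDiffOn ℝ (n + 1) f s) (v : E) :
    ContDiffOn ℝ n (fun y => fderivWithin ℝ f s y v) s :=
  ((contDiffOn_succ_iff_fderivWithin hs).1 hf).2.2.clm_apply contDiffOn_const

variable {V : Submodule ℝ (α → ℝ)} {G : α → E → ℝ}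

/-- Derivatives along tangent directions are limits of sequences of difference quotients, and the
tangent directions span a dense subspace. So a class of functions that is closed under linear
combinations and pointwise limits is closed under differentiation in a parameter. -/
lemma fderivWithin_apply_mem_of_isSeqClosed [FiniteDimensional ℝ E]
    (hV : IsSeqClosed (V : Set (α → ℝ))) (hs : UniqueDiffWithinAt ℝ s x) (hx : x ∈ s)
    (hG : ∀ y ∈ s, (fun u => G u y) ∈ V) (hd : ∀ u, DifferentiableWithinAt ℝ (G u) s x) (v : E) :
    (fun u => fderivWithin ℝ (G u) s x v) ∈ V := by
  let W : Submodule ℝ E :=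
    { carrier := {v | (fun u => fderivWithin ℝ (G u) s x v) ∈ V}
      add_mem' := fun {a b} ha hb => by
        simp only [Set.mem_ofPred_eq, map_add]
        exact V.add_mem ha hb
      zero_mem' := by
        simp only [Set.mem_ofPred_eq, map_zero]
        exact V.zero_mem
      smul_mem' := fun c a ha => by
        simp only [Set.mem_ofPred_eq, map_smul]
        exact V.smul_mem c ha }
  have hT : tangentConeAt ℝ s x ⊆ W := by
    intro w hw
    obtain ⟨c, e, he, hes, hce⟩ := mem_tangentConeAt_iff_exists_seq.1 hw
    obtain ⟨n₀, hn₀⟩ := eventually_atTop.1 hes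
    refine hV (x := fun n u => c (n + n₀) * (G u (x + e (n + n₀)) - G u x)) (fun n => ?_) ?_
    · exact V.smul_mem (c (n + n₀)) (V.sub_mem (hG _ (hn₀ _ (by omega))) (hG x hx))
    · rw [tendsto_pi_nhds]
      intro u
      exact ((hd u).hasFDerivWithinAt.lim he hes hce).comp (tendsto_add_atTop_nat n₀)
  have hW : (W : Set E) = Set.univ := by
    rw [← (W.closed_of_finiteDimensional).closure_eq]
    exact (hs.dense_tangentConeAt.mono (Submodule.span_le.2 hT)).closure_eq
  exact (hW ▸ Set.mem_univ v : v ∈ (W : Set E))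

lemma iteratedFDerivWithin_apply_mem_of_isSeqClosed [FiniteDimensional ℝ E]
    (hV : IsSeqClosed (V : Set (α → ℝ))) (hs : UniqueDiffOn ℝ s) {n : ℕ}
    (hG : ∀ y ∈ s, (fun u => G u y) ∈ V) (hd : ∀ u, ContDiffOn ℝ n (G u) s) (hx : x ∈ s)
    (v : Fin n → E) :
    (fun u => iteratedFDerivWithin ℝ n (G u) s x v) ∈ V := by
  induction n generalizing G with
  | zero => simpa using hG x hx
  | succ n ih =>
    have hd' (u : α) : ContDiffOn ℝ (n + 1) (G u) s := by exact_mod_cast hd u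
    simp_rw [fun u => iteratedFDerivWithin_succ_apply_eq_fderivWithin_apply hs (hd' u) hx v]
    refine ih (fun y hy => ?_) (fun u => (hd' u).fderivWithin_apply_const hs _) _
    exact fderivWithin_apply_mem_of_isSeqClosed hV (hs y hy) hy hG
      (fun u => (hd' u).differentiableOn (by simp) y hy) _

variable [MeasurableSpace α] {μ : Measure α} {ξ : α → ℝ}

/-- On the class `V`, integration against `ξ` is defined and commutes with pointwise limits of
families indexed by `E`, along countably generated filters. Limits to zero suffice, as `V` is a
vector space; filters rather than sequences are needed for `𝓝[s] x`. -/
structure IsLimitIntegrable (V : Submodule ℝ (α → ℝ)) (ξ : α → ℝ) (μ : Measure α)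
    (E : Type*) : Prop where
  integrable : ∀ f ∈ V, Integrable (fun u => f u * ξ u) μ
  tendsto : ∀ (l : Filter E) [l.IsCountablyGenerated] (q : E → α → ℝ), (∀ᶠ y in l, q y ∈ V) →
    (∀ u, Tendsto (q · u) l (𝓝 0)) → Tendsto (fun y => ∫ u, q y u * ξ u ∂μ) l (𝓝 0)

lemma IsLimitIntegrable.hasFDerivWithinAt [FiniteDimensional ℝ E]
    (hI : IsLimitIntegrable V ξ μ E)
    (hV : IsSeqClosed (V : Set (α → ℝ))) (hs : UniqueDiffWithinAt ℝ s x) (hx : x ∈ s)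
    (hG : ∀ y ∈ s, (fun u => G u y) ∈ V) (hd : ∀ u, DifferentiableWithinAt ℝ (G u) s x) :
    ∃ T : E →L[ℝ] ℝ, HasFDerivWithinAt (fun y => ∫ u, G u y * ξ u ∂μ) T s x ∧
      ∀ v, T v = ∫ u, fderivWithin ℝ (G u) s x v * ξ u ∂μ := by
  have hmem := fderivWithin_apply_mem_of_isSeqClosed hV hs hx hG hd
  let T₀ : E →ₗ[ℝ] ℝ :=
    { toFun := fun v => ∫ u, fderivWithin ℝ (G u) s x v * ξ u ∂μ
      map_add' := fun v w => by
        simp only [map_add, add_mul]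
        exact integral_add (hI.integrable _ (hmem v)) (hI.integrable _ (hmem w))
      map_smul' := fun c v => by
        simp only [map_smul, smul_eq_mul, mul_assoc, RingHom.id_apply]
        exact integral_const_mul _ _ }
  refine ⟨T₀.toContinuousLinearMap, ?_, fun v => rfl⟩
  rw [hasFDerivWithinAt_iff_tendsto]
  have key := hI.tendsto (𝓝[s] x)
    (fun y u => ‖y - x‖⁻¹ * (G u y - G u x - fderivWithin ℝ (G u) s x (y - x))) ?_ ?_
  · refine (tendsto_zero_iff_norm_tendsto_zero.1 key).congr' ?_
    filter_upwards [self_mem_nhdsWithin] with y hy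
    have h1 := hI.integrable _ (hG y hy)
    have h2 := hI.integrable _ (hG x hx)
    have h3 := hI.integrable _ (hmem (y - x))
    simp only [mul_assoc, integral_const_mul, sub_mul]
    have h12 : Integrable (fun u => G u y * ξ u - G u x * ξ u) μ := h1.sub h2
    rw [integral_sub h12 h3, integral_sub h1 h2, norm_mul, norm_inv, norm_norm]
    rfl
  · filter_upwards [self_mem_nhdsWithin] with y hy
    exact V.smul_mem _ (V.sub_mem (V.sub_mem (hG y hy) (hG x hx)) (hmem _))
  · intro u
    rw [tendsto_zero_iff_norm_tendsto_zero]
    refine (hasFDerivWithinAt_iff_tendsto.1 (hd u).hasFDerivWithinAt).congr fun y => ?_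
    rw [norm_mul, norm_inv, norm_norm]

lemma IsLimitIntegrable.fderivWithin_integral [FiniteDimensional ℝ E]
    (hI : IsLimitIntegrable V ξ μ E)
    (hV : IsSeqClosed (V : Set (α → ℝ))) (hs : UniqueDiffWithinAt ℝ s x) (hx : x ∈ s)
    (hG : ∀ y ∈ s, (fun u => G u y) ∈ V) (hd : ∀ u, DifferentiableWithinAt ℝ (G u) s x) (v : E) :
    fderivWithin ℝ (fun y => ∫ u, G u y * ξ u ∂μ) s x v =
      ∫ u, fderivWithin ℝ (G u) s x v * ξ u ∂μ := by
  obtain ⟨T, hT, hTv⟩ := hI.hasFDerivWithinAt hV hs hx hG hd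
  rw [hT.fderivWithin hs, hTv]

/-- If all sample functions `G u` are `C^n`, so is `y ↦ ∫ G u y ξ(u) dμ(u)`. -/
lemma IsLimitIntegrable.contDiffOn_integral [FiniteDimensional ℝ E]
    (hI : IsLimitIntegrable V ξ μ E)
    (hV : IsSeqClosed (V : Set (α → ℝ))) (hs : UniqueDiffOn ℝ s) {n : ℕ}
    (hG : ∀ y ∈ s, (fun u => G u y) ∈ V) (hd : ∀ u, ContDiffOn ℝ n (G u) s) :
    ContDiffOn ℝ n (fun y => ∫ u, G u y * ξ u ∂μ) s := by
  induction n generalizing G with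
  | zero =>
    simp only [CharP.cast_eq_zero, contDiffOn_zero] at hd ⊢
    intro x hx
    have key := hI.tendsto (𝓝[s] x) (fun y u => G u y - G u x) ?_ ?_
    · rw [ContinuousWithinAt, ← tendsto_sub_nhds_zero_iff]
      refine key.congr' ?_
      filter_upwards [self_mem_nhdsWithin] with y hy
      simp only [sub_mul]
      exact integral_sub (hI.integrable _ (hG y hy)) (hI.integrable _ (hG x hx))
    · filter_upwards [self_mem_nhdsWithin] with y hy using V.sub_mem (hG y hy) (hG x hx)
    · intro u
      exact tendsto_sub_nhds_zero_iff.2 (hd u x hx)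
  | succ n ih =>
    have hd' (u : α) : ContDiffOn ℝ (n + 1) (G u) s := by exact_mod_cast hd u
    have hd1 (u : α) : DifferentiableOn ℝ (G u) s := (hd' u).differentiableOn (by simp)
    push_cast
    rw [contDiffOn_succ_iff_fderivWithin hs]
    refine ⟨fun x hx => ?_, by simp, contDiffOn_clm_apply.2 fun v => ?_⟩
    · obtain ⟨T, hT, -⟩ := hI.hasFDerivWithinAt hV (hs x hx) hx hG (fun u => hd1 u x hx)
      exact hT.differentiableWithinAt
    · refine (ih (G := fun u y => fderivWithin ℝ (G u) s y v) (fun y hy => ?_)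
        fun u => (hd' u).fderivWithin_apply_const hs v).congr fun y hy => ?_
      · exact fderivWithin_apply_mem_of_isSeqClosed hV (hs y hy) hy hG
          (fun u => hd1 u y hy) v
      · exact hI.fderivWithin_integral hV (hs y hy) hy hG (fun u => hd1 u y hy) v

/-- Iterated derivatives in the parameter may be taken under the integral sign. -/
lemma IsLimitIntegrable.iteratedFDerivWithin_integral [FiniteDimensional ℝ E]
    (hI : IsLimitIntegrable V ξ μ E)
    (hV : IsSeqClosed (V : Set (α → ℝ))) (hs : UniqueDiffOn ℝ s) {n : ℕ}
    (hG : ∀ y ∈ s, (fun u => G u y) ∈ V) (hd : ∀ u, ContDiffOn ℝ n (G u) s) (hx : x ∈ s)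
    (v : Fin n → E) :
    iteratedFDerivWithin ℝ n (fun y => ∫ u, G u y * ξ u ∂μ) s x v =
      ∫ u, iteratedFDerivWithin ℝ n (G u) s x v * ξ u ∂μ := by
  induction n generalizing G with
  | zero => simp
  | succ n ih =>
    have hd' (u : α) : ContDiffOn ℝ (n + 1) (G u) s := by exact_mod_cast hd u
    have hd1 (u : α) : DifferentiableOn ℝ (G u) s := (hd' u).differentiableOn (by simp)
    have hc := hI.contDiffOn_integral hV hs hG hd
    rw [iteratedFDerivWithin_succ_apply_eq_fderivWithin_apply hs (by exact_mod_cast hc) hx]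
    simp_rw [fun u => iteratedFDerivWithin_succ_apply_eq_fderivWithin_apply hs (hd' u) hx v]
    rw [← ih (G := fun u y => fderivWithin ℝ (G u) s y (v (Fin.last n))) (fun y hy => ?_)
      fun u => (hd' u).fderivWithin_apply_const hs _]
    · congr 1
      refine iteratedFDerivWithin_congr (fun y hy => ?_) hx n
      exact hI.fderivWithin_integral hV (hs y hy) hy hG (fun u => hd1 u y hy) _
    · exact fderivWithin_apply_mem_of_isSeqClosed hV (hs y hy) hy hG
        (fun u => hd1 u y hy) _

end Derivatives

/-! ### Linear differential operators -/

namespace LinDiffOp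

variable {d m : ℕ} {Ω : Set (EuclideanSpace ℝ (Fin d))} (𝒟 : LinDiffOp d m)
  {z : EuclideanSpace ℝ (Fin d)}

lemma app_congr {f g : EuclideanSpace ℝ (Fin d) → ℝ} (h : Set.EqOn f g Ω) (hz : z ∈ Ω) :
    𝒟.app Ω f z = 𝒟.app Ω g z := by
  simp only [app, iteratedFDerivWithin_congr h hz]

lemma cast_le_of_fin (j : Fin (m + 1)) : ((j : ℕ) : WithTop ℕ∞) ≤ m := by
  exact_mod_cast Nat.lt_succ_iff.1 j.2

lemma app_sub (hΩ : UniqueDiffOn ℝ Ω) {f g : EuclideanSpace ℝ (Fin d) → ℝ}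
    (hf : ContDiffOn ℝ m f Ω) (hg : ContDiffOn ℝ m g Ω) (hz : z ∈ Ω) :
    𝒟.app Ω (fun y => f y - g y) z = 𝒟.app Ω f z - 𝒟.app Ω g z := by
  simp only [app, ← Finset.sum_sub_distrib, ← mul_sub]
  refine Finset.sum_congr rfl fun j _ => Finset.sum_congr rfl fun I _ => ?_
  have := iteratedFDerivWithin_sub_apply ((hf z hz).of_le (cast_le_of_fin j))
    ((hg z hz).of_le (cast_le_of_fin j)) hΩ hz
  rw [show (fun y => f y - g y) = f - g from rfl, this]
  rfl

lemma app_mul_const (hΩ : UniqueDiffOn ℝ Ω) {f : EuclideanSpace ℝ (Fin d) → ℝ}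
    (hf : ContDiffOn ℝ m f Ω) (hz : z ∈ Ω) (c : ℝ) :
    𝒟.app Ω (fun y => f y * c) z = 𝒟.app Ω f z * c := by
  simp only [app, Finset.sum_mul]
  refine Finset.sum_congr rfl fun j _ => Finset.sum_congr rfl fun I _ => ?_
  have := iteratedFDerivWithin_const_smul_apply (a := c) ((hf z hz).of_le (cast_le_of_fin j)) hΩ hz
  rw [show (fun y => f y * c) = c • f by ext; simp [mul_comm], this]
  simp
  ring

lemma app_sum (hΩ : UniqueDiffOn ℝ Ω) {ι : Type*} (s : Finset ι)
    {f : ι → EuclideanSpace ℝ (Fin d) → ℝ}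
    (hf : ∀ i ∈ s, ContDiffOn ℝ m (f i) Ω) (hz : z ∈ Ω) :
    𝒟.app Ω (fun y => ∑ i ∈ s, f i y) z = ∑ i ∈ s, 𝒟.app Ω (f i) z := by
  simp only [app]
  rw [Finset.sum_comm]
  refine Finset.sum_congr rfl fun j _ => ?_
  rw [Finset.sum_comm]
  refine Finset.sum_congr rfl fun I _ => ?_
  have := iteratedFDerivWithin_fun_sum_apply hΩ hz
    (fun i hi => (hf i hi z hz).of_le (cast_le_of_fin j))
  rw [this, ← Finset.mul_sum]
  simp

variable {α : Type*} {V : Submodule ℝ (α → ℝ)} {G : α → EuclideanSpace ℝ (Fin d) → ℝ}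

lemma app_mem_of_isSeqClosed (hV : IsSeqClosed (V : Set (α → ℝ))) (hΩ : UniqueDiffOn ℝ Ω)
    (hG : ∀ y ∈ Ω, (fun u => G u y) ∈ V) (hd : ∀ u, ContDiffOn ℝ m (G u) Ω) (hz : z ∈ Ω) :
    (fun u => 𝒟.app Ω (G u) z) ∈ V := by
  have h : (fun u => 𝒟.app Ω (G u) z) = ∑ j : Fin (m + 1), ∑ I : Fin j → Fin d,
      𝒟.coeff j I z • (fun u => iteratedFDerivWithin ℝ j (G u) Ω z
        (fun l => EuclideanSpace.single (I l) (1 : ℝ))) := by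
    ext u
    simp [app]
  rw [h]
  exact V.sum_mem fun j _ => V.sum_mem fun I _ => V.smul_mem _
    (iteratedFDerivWithin_apply_mem_of_isSeqClosed hV hΩ hG
      (fun u => (hd u).of_le (cast_le_of_fin j)) hz _)

/-- A linear differential operator may be applied under the integral sign. -/
lemma app_integral [MeasurableSpace α] {μ : Measure α} {ξ : α → ℝ}
    (hI : IsLimitIntegrable V ξ μ (EuclideanSpace ℝ (Fin d)))
    (hV : IsSeqClosed (V : Set (α → ℝ))) (hΩ : UniqueDiffOn ℝ Ω)
    (hG : ∀ y ∈ Ω, (fun u => G u y) ∈ V) (hd : ∀ u, ContDiffOn ℝ m (G u) Ω) (hz : z ∈ Ω) :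
    𝒟.app Ω (fun y => ∫ u, G u y * ξ u ∂μ) z = ∫ u, 𝒟.app Ω (G u) z * ξ u ∂μ := by
  have hint (j : Fin (m + 1)) (I : Fin j → Fin d) := hI.integrable _
    (iteratedFDerivWithin_apply_mem_of_isSeqClosed hV hΩ hG
      (fun u => (hd u).of_le (cast_le_of_fin j)) hz
      (fun l => EuclideanSpace.single (I l) (1 : ℝ)))
  simp only [app, Finset.sum_mul, mul_assoc]
  rw [integral_finsetSum _ fun j _ => integrable_finsetSum _ fun I _ => (hint j I).const_mul _]
  refine Finset.sum_congr rfl fun j _ => ?_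
  rw [integral_finsetSum _ fun I _ => (hint j I).const_mul _]
  refine Finset.sum_congr rfl fun I _ => ?_
  rw [integral_const_mul, hI.iteratedFDerivWithin_integral hV hΩ hG
    (fun u => (hd u).of_le (cast_le_of_fin j)) hz]

end LinDiffOp

/-! ### The Gaussian space of a centred Gaussian process -/

section GaussianSpace

variable {α T : Type*} [MeasurableSpace α] {μ : Measure α} {Y : T → α → ℝ}

lemma norm_toLp_sq {f : α → ℝ} (hf : MemLp f 2 μ) : ‖hf.toLp f‖ ^ 2 = ∫ u, f u ^ 2 ∂μ := by
  rw [← real_inner_self_eq_norm_sq, L2.inner_def]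
  refine integral_congr_ae ?_
  filter_upwards [hf.coeFn_toLp] with u hu
  simp [hu, sq]

lemma inner_toLp {f g : α → ℝ} (hf : MemLp f 2 μ) (hg : MemLp g 2 μ) :
    inner ℝ (hf.toLp f) (hg.toLp g) = ∫ u, f u * g u ∂μ := by
  rw [L2.inner_def]
  refine integral_congr_ae ?_
  filter_upwards [hf.coeFn_toLp, hg.coeFn_toLp] with u hu hv
  simp [hu, hv, mul_comm]

/-- The closed linear span of the process `Y` in `L²(μ)`. -/
noncomputable def gaussianClosure (Y : T → α → ℝ) (μ : Measure α) : Submodule ℝ (Lp ℝ 2 μ) :=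
  (Submodule.span ℝ {h | ∃ t, ∃ hf : MemLp (Y t) 2 μ, h = hf.toLp (Y t)}).topologicalClosure

/-- The functions (not classes of functions) whose class in `L²(μ)` lies in the closed linear span
of the process `Y`. -/
noncomputable def gaussianSpace (Y : T → α → ℝ) (μ : Measure α) : Submodule ℝ (α → ℝ) where
  carrier := {f | ∃ hf : MemLp f 2 μ, hf.toLp f ∈ gaussianClosure Y μ}
  add_mem' := by
    rintro f g ⟨hf, hf'⟩ ⟨hg, hg'⟩
    exact ⟨hf.add hg, by rw [MemLp.toLp_add hf hg]; exact Submodule.add_mem _ hf' hg'⟩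
  zero_mem' := ⟨MemLp.zero, by rw [MemLp.toLp_zero]; exact Submodule.zero_mem _⟩
  smul_mem' := by
    rintro c f ⟨hf, hf'⟩
    exact ⟨hf.const_smul c, by rw [MemLp.toLp_const_smul c hf]; exact Submodule.smul_mem _ _ hf'⟩

lemma mem_gaussianSpace (hY : IsGaussianProcess Y μ) (t : T) :
    Y t ∈ gaussianSpace Y μ :=
  ⟨(hY.hasGaussianLaw_eval t).memLp_two,
    Submodule.le_topologicalClosure _ (Submodule.subset_span ⟨t, _, rfl⟩)⟩

lemma integral_cexp_of_hasGaussianLaw {f : α → ℝ} (hf : HasGaussianLaw f μ)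
    (h0 : ∫ u, f u ∂μ = 0) :
    ∫ u, Complex.exp (f u * Complex.I) ∂μ = Complex.exp (-((∫ u, f u ^ 2 ∂μ : ℝ) : ℂ) / 2) := by
  have h := hf.charFun_map_eq 1
  have hv : Var[f; μ] = ∫ u, f u ^ 2 ∂μ := variance_of_integral_eq_zero hf.aemeasurable h0
  simp only [RCLike.inner_apply, conj_trivial, mul_one, h0, hv] at h
  rw [charFun_apply, integral_map hf.aemeasurable (by fun_prop)] at h
  simp only [RCLike.inner_apply, conj_trivial, one_mul] at h
  rw [h]
  simp [neg_div]

lemma integral_cexp_of_mem_span (hY : IsGaussianProcess Y μ) (h0 : ∀ t, ∫ u, Y t u ∂μ = 0)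
    {h : Lp ℝ 2 μ}
    (hh : h ∈ Submodule.span ℝ {h | ∃ t, ∃ hf : MemLp (Y t) 2 μ, h = hf.toLp (Y t)}) :
    ∫ u, Complex.exp (h u * Complex.I) ∂μ = Complex.exp (-((‖h‖ ^ 2 : ℝ) : ℂ) / 2) := by
  have hL (t : T) : MemLp (Y t) 2 μ := (hY.hasGaussianLaw_eval t).memLp_two
  have hset : {h | ∃ t, ∃ hf : MemLp (Y t) 2 μ, h = hf.toLp (Y t)} =
      Set.range fun t => (hL t).toLp (Y t) := by
    ext g
    exact ⟨fun ⟨t, _, ht⟩ => ⟨t, ht.symm⟩, fun ⟨t, ht⟩ => ⟨t, _, ht.symm⟩⟩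
  rw [hset, Finsupp.mem_span_range_iff_exists_finsupp] at hh
  obtain ⟨c, rfl⟩ := hh
  let f : α → ℝ := fun u => ∑ t ∈ c.support, c t • Y t u
  have hf : HasGaussianLaw f μ := (hY.smul c).hasGaussianLaw_fun_sum
  have hf0 : ∫ u, f u ∂μ = 0 := by
    simp only [f]
    have hi (t : T) : Integrable (fun u => c t • Y t u) μ :=
      ((hY.hasGaussianLaw_eval t).integrable).smul (c t)
    rw [integral_finsetSum _ fun t _ => hi t]
    simp [integral_const_mul, h0]
  have heq : c.sum (fun t a => a • (hL t).toLp (Y t)) = hf.memLp_two.toLp f := by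
    have : f = ∑ t ∈ c.support, c t • Y t := by ext u; simp [f]
    apply Lp.ext
    refine EventuallyEq.trans ?_ hf.memLp_two.coeFn_toLp.symm
    rw [this, Finsupp.sum]
    have hsum : ∀ s : Finset T, (↑(∑ t ∈ s, c t • (hL t).toLp (Y t)) : α → ℝ) =ᵐ[μ]
        ∑ t ∈ s, c t • Y t := by
      classical
      intro s
      induction s using Finset.induction_on with
      | empty => simpa using Lp.coeFn_zero ℝ 2 μ
      | insert t s hts ih =>
        rw [Finset.sum_insert hts, Finset.sum_insert hts]
        exact (Lp.coeFn_add _ _).trans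
          (((Lp.coeFn_smul _ _).trans ((hL t).coeFn_toLp.const_smul (c t))).add ih)
    exact hsum _
  rw [heq, norm_toLp_sq, ← integral_cexp_of_hasGaussianLaw hf hf0]
  refine integral_congr_ae ?_
  filter_upwards [hf.memLp_two.coeFn_toLp] with u hu
  rw [hu]

/-- The formula for the characteristic function of a centred Gaussian variable is preserved under
limits in `L²`, since these are limits almost everywhere along a subsequence. -/
lemma integral_cexp_of_mem_gaussianClosure (hY : IsGaussianProcess Y μ)
    (h0 : ∀ t, ∫ u, Y t u ∂μ = 0) {h : Lp ℝ 2 μ} (hh : h ∈ gaussianClosure Y μ) :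
    ∫ u, Complex.exp (h u * Complex.I) ∂μ = Complex.exp (-((‖h‖ ^ 2 : ℝ) : ℂ) / 2) := by
  have := hY.isProbabilityMeasure
  obtain ⟨g, hg, hgh⟩ := mem_closure_iff_seq_limit.1 hh
  obtain ⟨φ, hφ, hae⟩ := (tendstoInMeasure_of_tendsto_Lp hgh).exists_seq_tendsto_ae
  have h1 : Tendsto (fun n => ∫ u, Complex.exp (g (φ n) u * Complex.I) ∂μ) atTop
      (𝓝 (∫ u, Complex.exp (h u * Complex.I) ∂μ)) := by
    refine tendsto_integral_of_dominated_convergence (fun _ => 1) (fun n => ?_)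
      (integrable_const _) (fun n => ?_) ?_
    · have := (Lp.aestronglyMeasurable (g (φ n)))
      exact (Complex.continuous_exp.comp
        (Complex.continuous_ofReal.mul continuous_const)).comp_aestronglyMeasurable this
    · exact Eventually.of_forall fun u => by rw [Complex.norm_exp_ofReal_mul_I]
    · filter_upwards [hae] with u hu
      exact ((Complex.continuous_exp.comp
        (Complex.continuous_ofReal.mul continuous_const)).tendsto _).comp hu
  have h2 : Tendsto (fun n => Complex.exp (-((‖g (φ n)‖ ^ 2 : ℝ) : ℂ) / 2)) atTop
      (𝓝 (Complex.exp (-((‖h‖ ^ 2 : ℝ) : ℂ) / 2))) := by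
    have hc : Continuous fun f : Lp ℝ 2 μ => Complex.exp (-((‖f‖ ^ 2 : ℝ) : ℂ) / 2) := by fun_prop
    exact (hc.tendsto h).comp (hgh.comp hφ.tendsto_atTop)
  refine tendsto_nhds_unique h1 (h2.congr fun n => ?_)
  exact (integral_cexp_of_mem_span hY h0 (hg _)).symm

lemma integral_cexp_of_mem_gaussianSpace (hY : IsGaussianProcess Y μ)
    (h0 : ∀ t, ∫ u, Y t u ∂μ = 0) {f : α → ℝ} (hf : f ∈ gaussianSpace Y μ) :
    ∫ u, Complex.exp (f u * Complex.I) ∂μ = Complex.exp (-((∫ u, f u ^ 2 ∂μ : ℝ) : ℂ) / 2) := by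
  obtain ⟨hL, hf⟩ := hf
  rw [← norm_toLp_sq hL, ← integral_cexp_of_mem_gaussianClosure hY h0 hf]
  refine integral_congr_ae ?_
  filter_upwards [hL.coeFn_toLp] with u hu
  rw [hu]

lemma integral_eq_zero_of_mem_gaussianSpace (hY : IsGaussianProcess Y μ)
    (h0 : ∀ t, ∫ u, Y t u ∂μ = 0) {f : α → ℝ} (hf : f ∈ gaussianSpace Y μ) :
    ∫ u, f u ∂μ = 0 := by
  have := hY.isProbabilityMeasure
  obtain ⟨hL, hf⟩ := hf
  have h1 : MemLp (fun _ : α => (1 : ℝ)) 2 μ := memLp_const 1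
  let Λ := innerSL ℝ (h1.toLp _)
  have hle : gaussianClosure Y μ ≤ LinearMap.ker Λ.toLinearMap := by
    refine Submodule.topologicalClosure_minimal _ (Submodule.span_le.2 ?_) Λ.isClosed_ker
    rintro _ ⟨t, ht, rfl⟩
    have : inner ℝ (h1.toLp _) (ht.toLp (Y t)) = 0 := by
      rw [inner_toLp]
      simp [h0]
    exact this
  have h2 : inner ℝ (h1.toLp _) (hL.toLp f) = 0 := hle hf
  rw [inner_toLp] at h2
  simpa using h2

/-- On the Gaussian space, pointwise convergence to zero implies convergence in `L²`, because the
variance of a centred Gaussian variable can be read off from its characteristic function. -/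
lemma tendsto_integral_sq_of_mem_gaussianSpace (hY : IsGaussianProcess Y μ)
    (h0 : ∀ t, ∫ u, Y t u ∂μ = 0) {ι : Type*} {l : Filter ι} [l.IsCountablyGenerated]
    {q : ι → α → ℝ} (hq : ∀ᶠ i in l, q i ∈ gaussianSpace Y μ)
    (hlim : ∀ u, Tendsto (q · u) l (𝓝 0)) :
    Tendsto (fun i => ∫ u, q i u ^ 2 ∂μ) l (𝓝 0) := by
  have := hY.isProbabilityMeasure
  have hc : Continuous fun r : ℝ => Complex.exp (r * Complex.I) := by fun_prop
  have h1 : Tendsto (fun i => ∫ u, Complex.exp (q i u * Complex.I) ∂μ) l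
      (𝓝 (∫ _, Complex.exp ((0 : ℝ) * Complex.I) ∂μ)) := by
    refine tendsto_integral_filter_of_dominated_convergence (fun _ => 1) ?_ ?_
      (integrable_const _) ?_
    · filter_upwards [hq] with i hi
      exact hc.comp_aestronglyMeasurable hi.1.aestronglyMeasurable
    · exact Eventually.of_forall fun i => Eventually.of_forall fun u => by
        rw [Complex.norm_exp_ofReal_mul_I]
    · exact Eventually.of_forall fun u => (hc.tendsto 0).comp (hlim u)
  have h2 : Tendsto (fun i => Real.exp (-(∫ u, q i u ^ 2 ∂μ) / 2)) l (𝓝 1) := by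
    have := h1.norm
    simp only [Complex.ofReal_zero, zero_mul, Complex.exp_zero, integral_const, probReal_univ,
      one_smul, norm_one] at this
    refine this.congr' ?_
    filter_upwards [hq] with i hi
    rw [integral_cexp_of_mem_gaussianSpace hY h0 hi, Complex.norm_exp]
    congr 1
    rw [← Complex.ofReal_neg, ← Complex.ofReal_ofNat, ← Complex.ofReal_div, Complex.ofReal_re]
  have h3 := ((Real.continuousAt_log one_ne_zero).tendsto.comp h2).const_mul (-2)
  simp only [Real.log_one, mul_zero] at h3
  refine h3.congr fun i => ?_
  simp only [Function.comp_apply, Real.log_exp]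
  ring

/-- The Gaussian space is closed under pointwise limits of sequences: such a sequence is Cauchy
in `L²`. -/
lemma isSeqClosed_gaussianSpace (hY : IsGaussianProcess Y μ) (h0 : ∀ t, ∫ u, Y t u ∂μ = 0) :
    IsSeqClosed (gaussianSpace Y μ : Set (α → ℝ)) := by
  intro g f hg hgf
  rw [tendsto_pi_nhds] at hgf
  have hsq := tendsto_integral_sq_of_mem_gaussianSpace hY h0
    (l := (atTop : Filter (ℕ × ℕ))) (q := fun p => g p.1 - g p.2)
    (Eventually.of_forall fun p => Submodule.sub_mem _ (hg _) (hg _)) (fun u => by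
      rw [← prod_atTop_atTop_eq]
      simpa using ((hgf u).comp tendsto_fst).sub ((hgf u).comp tendsto_snd))
  have hcau : CauchySeq fun n => (hg n).1.toLp (g n) := by
    rw [cauchySeq_iff_tendsto_dist_atTop_0]
    have := hsq.sqrt
    rw [Real.sqrt_zero] at this
    refine this.congr fun p => ?_
    rw [dist_eq_norm, ← MemLp.toLp_sub, ← norm_toLp_sq ((hg p.1).1.sub (hg p.2).1),
      Real.sqrt_sq (norm_nonneg _)]
  obtain ⟨h, hh⟩ := cauchySeq_tendsto_of_complete hcau
  have hmem : h ∈ gaussianClosure Y μ :=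
    (Submodule.isClosed_topologicalClosure _).mem_of_tendsto hh
      (Eventually.of_forall fun n => (hg n).2)
  obtain ⟨φ, hφ, hae⟩ := (tendstoInMeasure_of_tendsto_Lp hh).exists_seq_tendsto_ae
  have hfh : h =ᵐ[μ] f := by
    have hall : ∀ᵐ u ∂μ, ∀ n, (hg n).1.toLp (g n) u = g n u :=
      ae_all_iff.2 fun n => (hg n).1.coeFn_toLp
    filter_upwards [hae, hall] with u hu hu'
    simp only [hu'] at hu
    exact tendsto_nhds_unique hu ((hgf u).comp hφ.tendsto_atTop)
  have hfL : MemLp f 2 μ := (Lp.memLp h).ae_eq hfh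
  refine ⟨hfL, ?_⟩
  have : hfL.toLp f = h := Lp.ext (hfL.coeFn_toLp.trans hfh.symm)
  rwa [this]

lemma hasGaussianLaw_of_mem_gaussianSpace (hY : IsGaussianProcess Y μ)
    (h0 : ∀ t, ∫ u, Y t u ∂μ = 0) {f : α → ℝ} (hf : f ∈ gaussianSpace Y μ) :
    HasGaussianLaw f μ := by
  have := hY.isProbabilityMeasure
  have hm : AEMeasurable f μ := hf.1.aestronglyMeasurable.aemeasurable
  rw [hasGaussianLaw_iff_charFun_map_eq hm]
  intro t
  have ht : (fun u => t * f u) ∈ gaussianSpace Y μ := Submodule.smul_mem _ t hf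
  have h1 := integral_cexp_of_mem_gaussianSpace hY h0 ht
  have h2 := integral_eq_zero_of_mem_gaussianSpace hY h0 ht
  have hv := variance_of_integral_eq_zero (hm.const_mul t) h2
  have hin : (fun u => inner ℝ t (f u)) = fun u => t * f u := by
    ext u
    simp [mul_comm]
  rw [hin, h2, hv, charFun_apply, integral_map hm (by fun_prop)]
  simp only [RCLike.inner_apply, conj_trivial]
  rw [h1]
  simp [neg_div]

lemma isGaussianProcess_of_mem_gaussianSpace (hY : IsGaussianProcess Y μ)
    (h0 : ∀ t, ∫ u, Y t u ∂μ = 0) {T' : Type*} {Z : T' → α → ℝ}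
    (hZ : ∀ t, Z t ∈ gaussianSpace Y μ) : IsGaussianProcess Z μ where
  hasGaussianLaw I := by
    have := hY.isProbabilityMeasure
    have hm : AEMeasurable (fun u => I.restrict (Z · u)) μ :=
      aemeasurable_pi_lambda _ fun i => (hZ i).1.aestronglyMeasurable.aemeasurable
    refine ⟨isGaussian_of_isGaussian_map fun L => ?_⟩
    rw [AEMeasurable.map_map_of_aemeasurable (by fun_prop) hm]
    refine (hasGaussianLaw_of_mem_gaussianSpace hY h0 ?_).isGaussian_map
    classical
    have : (L ∘ fun u => I.restrict (Z · u)) = ∑ i : I, L (Pi.single i 1) • Z i := by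
      ext u
      simp only [Function.comp_apply, Finset.sum_apply, Pi.smul_apply, smul_eq_mul]
      conv_lhs => rw [← Finset.univ_sum_single (I.restrict (Z · u)), map_sum]
      refine Finset.sum_congr rfl fun i _ => ?_
      rw [mul_comm, ← smul_eq_mul, ← map_smul, ← Pi.single_smul]
      simp
    rw [this]
    exact Submodule.sum_mem _ fun i _ => Submodule.smul_mem _ _ (hZ i)

lemma isLimitIntegrable_gaussianSpace (hY : IsGaussianProcess Y μ)
    (h0 : ∀ t, ∫ u, Y t u ∂μ = 0) {ξ : α → ℝ} (hξ : MemLp ξ 2 μ) (E : Type*) :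
    IsLimitIntegrable (gaussianSpace Y μ) ξ μ E where
  integrable f hf := hf.1.integrable_mul hξ
  tendsto l _ q hq hlim := by
    have h := (tendsto_integral_sq_of_mem_gaussianSpace hY h0 hq hlim).sqrt.mul_const
      ‖hξ.toLp ξ‖
    rw [Real.sqrt_zero, zero_mul] at h
    refine squeeze_zero_norm' ?_ h
    filter_upwards [hq] with y hy
    rw [← inner_toLp hy.1 hξ, ← norm_toLp_sq hy.1, Real.sqrt_sq (norm_nonneg _)]
    exact norm_inner_le_norm _ _

end GaussianSpace

/-! ### Gaussian processes with given moments -/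

section IsGPWith

variable {T α β : Type*} [MeasurableSpace α] [MeasurableSpace β] {P : Measure α}
  {Y Z : T → α → ℝ} {mean : T → ℝ} {c : T → T → ℝ}

lemma IsGPWith.congr (h : IsGPWith Y mean c P) (hYZ : ∀ t, Y t =ᵐ[P] Z t) :
    IsGPWith Z mean c P := by
  refine ⟨h.1.congr hYZ, fun t => ?_, fun s t => ?_⟩
  · rw [← h.2.1 t, integral_congr_ae (hYZ t)]
  · rw [← h.2.2 s t, covariance, covariance, integral_congr_ae (hYZ s), integral_congr_ae (hYZ t)]
    refine integral_congr_ae ?_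
    filter_upwards [hYZ s, hYZ t] with ω hs ht
    rw [hs, ht]

lemma isGPWith_map_iff {ρ : α → β} (hρ : Measurable ρ) {g : T → β → ℝ}
    (hg : ∀ t, Measurable (g t)) :
    IsGPWith g mean c (P.map ρ) ↔ IsGPWith (fun t => g t ∘ ρ) mean c P := by
  have h1 : IsGaussianProcess g (P.map ρ) ↔ IsGaussianProcess (fun t => g t ∘ ρ) P := by
    have h (I : Finset T) : ((P.map ρ).map fun ω => I.restrict (g · ω)) =
        P.map fun ω => I.restrict (fun t => (g t ∘ ρ) ω) :=
      Measure.map_map (measurable_pi_lambda _ fun i => hg i) hρ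
    exact ⟨fun H => ⟨fun I => ⟨h I ▸ (H.hasGaussianLaw I).isGaussian_map⟩⟩,
      fun H => ⟨fun I => ⟨h I ▸ (H.hasGaussianLaw I).isGaussian_map⟩⟩⟩
  have h2 (t : T) : ∫ ω, g t ω ∂(P.map ρ) = ∫ ω, (g t ∘ ρ) ω ∂P :=
    integral_map hρ.aemeasurable (hg t).aestronglyMeasurable
  have h3 (s t : T) : cov[g s, g t; P.map ρ] = cov[g s ∘ ρ, g t ∘ ρ; P] :=
    covariance_map (hg s).aestronglyMeasurable (hg t).aestronglyMeasurable hρ.aemeasurable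
  simp only [IsGPWith, h1, h2, h3]

/-- Two measures that agree on the `σ`-algebra generated by `ρ` assign the same law to a process
that is measurable with respect to it. -/
lemma IsGPWith.of_map_eq {ρ : α → β} (hρ : Measurable ρ) {P' : Measure α}
    (hP : P'.map ρ = P.map ρ)
    (hY : ∀ t, Measurable[MeasurableSpace.comap ρ inferInstance] (Y t))
    (h : IsGPWith Y mean c P) : IsGPWith Y mean c P' := by
  choose g hg hgY using fun t => (hY t).exists_eq_measurable_comp
  obtain rfl : Y = fun t => g t ∘ ρ := funext hgY
  rwa [← isGPWith_map_iff hρ hg, hP, isGPWith_map_iff hρ hg]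

lemma IsGPWith.add_const (h : IsGPWith Y mean c P) (b : T → ℝ) :
    IsGPWith (fun t ω => Y t ω + b t) (fun t => mean t + b t) c P := by
  have := h.1.isProbabilityMeasure
  have hi (t : T) : Integrable (Y t) P := (h.1.hasGaussianLaw_eval t).integrable
  refine ⟨⟨fun I => ⟨?_⟩⟩, fun t => ?_, fun s t => ?_⟩
  · have hI := (h.1.hasGaussianLaw I)
    have hG := hI.isGaussian_map
    have : (fun ω => I.restrict fun t => Y t ω + b t) =
        (fun x => x + I.restrict b) ∘ fun ω => I.restrict (Y · ω) := rfl
    rw [this, ← AEMeasurable.map_map_of_aemeasurable (by fun_prop) hI.aemeasurable]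
    infer_instance
  · rw [integral_add (hi t) (integrable_const _), h.2.1]
    simp
  · rw [covariance_add_const_left (hi s), covariance_add_const_right (hi t), h.2.2]

lemma IsGPWith.comp_right {T' : Type*} (h : IsGPWith Y mean c P) (f : T' → T) :
    IsGPWith (fun t => Y (f t)) (fun t => mean (f t)) (fun s t => c (f s) (f t)) P :=
  ⟨h.1.comp_right f, fun t => h.2.1 (f t), fun s t => h.2.2 (f s) (f t)⟩

lemma IsGPWith.variance_sum {ι : Type*} [Fintype ι] {Y : ι → α → ℝ} {mean : ι → ℝ}
    {C : Matrix ι ι ℝ} (h : IsGPWith Y mean C P) (t : ι → ℝ) :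
    Var[fun ω => ∑ i, t i • Y i ω; P] = dotProduct t (C.mulVec t) := by
  have := h.1.isProbabilityMeasure
  have hL (i : ι) : MemLp (fun ω => t i • Y i ω) 2 P :=
    (h.1.hasGaussianLaw_eval i).memLp_two.const_smul (t i)
  rw [variance_fun_sum' fun i _ => hL i]
  simp only [dotProduct, Matrix.mulVec, Finset.mul_sum]
  refine Finset.sum_congr rfl fun i _ => Finset.sum_congr rfl fun j _ => ?_
  simp only [smul_eq_mul]
  rw [covariance_const_mul_left, covariance_const_mul_right, h.2.2]
  ring

lemma IsGPWith.posSemidef {ι : Type*} [Fintype ι] {Y : ι → α → ℝ} {mean : ι → ℝ}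
    {C : Matrix ι ι ℝ} (h : IsGPWith Y mean C P) : C.PosSemidef := by
  refine Matrix.posSemidef_iff_dotProduct_mulVec.2 ⟨Matrix.IsHermitian.ext fun i j => ?_,
    fun t => ?_⟩
  · rw [← h.2.2 i j, ← h.2.2 j i, covariance_comm]
    rfl
  · rw [star_trivial, ← h.variance_sum t]
    exact variance_nonneg _ _

/-- A Gaussian process with finite index set is a Gaussian vector. -/
lemma IsGPWith.map_toLp {ι : Type*} [Fintype ι] [DecidableEq ι] {Y : ι → α → ℝ} {mean : ι → ℝ}
    {C : Matrix ι ι ℝ} (h : IsGPWith Y mean C P) :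
    P.map (fun ω => WithLp.toLp 2 fun i => Y i ω) =
      multivariateGaussian (WithLp.toLp 2 mean) C := by
  have := h.1.isProbabilityMeasure
  have hm : AEMeasurable (fun ω => WithLp.toLp 2 fun i => Y i ω : α → EuclideanSpace ℝ ι) P :=
    (WithLp.measurable_toLp 2 (ι → ℝ)).comp_aemeasurable
      (aemeasurable_pi_lambda _ fun i => h.1.aemeasurable i)
  have := P.isProbabilityMeasure_map hm
  refine Measure.ext_of_charFun (funext fun t => ?_)
  have hG : HasGaussianLaw (fun ω => ∑ i, t i • Y i ω) P :=
    (h.1.smul fun i => t i).hasGaussianLaw_fun_sum (I := Finset.univ)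
  have hL (i : ι) : MemLp (fun ω => t i • Y i ω) 2 P :=
    (h.1.hasGaussianLaw_eval i).memLp_two.const_smul (t i)
  have key := hG.charFun_map_eq 1
  have hin : (fun ω => inner ℝ (1 : ℝ) (∑ i, t i • Y i ω)) = fun ω => ∑ i, t i • Y i ω := by
    ext ω
    simp
  have hmean : ∫ ω, ∑ i, t i • Y i ω ∂P = ∑ i, t i * mean i := by
    rw [integral_finsetSum _ fun i _ => (hL i).integrable one_le_two]
    refine Finset.sum_congr rfl fun i _ => ?_
    rw [integral_smul, h.2.1, smul_eq_mul]
  rw [hin, hmean, h.variance_sum, charFun_apply, integral_map hG.aemeasurable (by fun_prop)] at key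
  rw [charFun_multivariateGaussian h.posSemidef, charFun_apply, integral_map hm (by fun_prop)]
  have e1 (ω : α) : inner ℝ (WithLp.toLp 2 fun i => Y i ω : EuclideanSpace ℝ ι) t =
      ∑ i, t i • Y i ω := by
    simp [PiLp.inner_apply]
  have e2 : inner ℝ t (WithLp.toLp 2 mean : EuclideanSpace ℝ ι) = ∑ i, t i * mean i := by
    simp [PiLp.inner_apply, mul_comm]
  simp only [RCLike.inner_apply, conj_trivial, one_mul] at key
  simp only [e1, e2]
  exact_mod_cast key

end IsGPWith

/-! ### Disintegrations -/

section Disintegration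

variable {𝒳 𝒜 ℛ : Type*} [MeasurableSpace 𝒳] [MeasurableSpace 𝒜] [MeasurableSpace ℛ]
  {μ : Measure 𝒳} {A : 𝒳 → 𝒜} {κ : Kernel 𝒜 𝒳}

lemma exists_isDisintegration [StandardBorelSpace 𝒳] [Nonempty 𝒳] [MeasurableEq 𝒜]
    [IsProbabilityMeasure μ] (hA : Measurable A) :
    ∃ κ : Kernel 𝒜 𝒳, IsDisintegration κ μ A := by
  have hc := compProd_map_condDistrib (mβ := ‹MeasurableSpace 𝒜›) (μ := μ) (X := A) (Y := id) aemeasurable_id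
  have := Measure.isProbabilityMeasure_map (μ := μ) hA.aemeasurable
  refine ⟨condDistrib id A μ, inferInstance, ?_, fun f hf => ?_⟩
  · have h : ∀ᵐ p ∂(μ.map A ⊗ₘ condDistrib id A μ), A p.2 = p.1 := by
      rw [hc, ae_map_iff (by fun_prop) (measurableSet_eq_fun (by fun_prop) (by fun_prop))]
      exact Eventually.of_forall fun x => rfl
    filter_upwards [Measure.ae_ae_of_ae_compProd h] with a ha
    exact ha
  · rw [← Measure.lintegral_compProd (f := fun p => f p.2) (by fun_prop), hc,
      lintegral_map (by fun_prop) (by fun_prop)]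
    rfl

/-- A disintegration is a version of the conditional distribution given `A`. -/
lemma IsDisintegration.compProd_eq [IsProbabilityMeasure μ] (h : IsDisintegration κ μ A)
    (hA : Measurable A) : μ.map A ⊗ₘ κ = μ.map fun x => (A x, x) := by
  have := h.isMarkov
  have := Measure.isProbabilityMeasure_map (μ := μ) hA.aemeasurable
  have hm : Measurable fun x => (A x, x) := hA.prodMk measurable_id
  ext S hS
  rw [Measure.compProd_apply hS, Measure.map_apply hm hS, ← lintegral_indicator_one (hm hS),
    h.lintegral_eq _ (measurable_one.indicator (hm hS))]
  refine lintegral_congr_ae ?_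
  filter_upwards [h.concentrated] with a ha
  rw [lintegral_indicator_one (hm hS)]
  refine measure_congr ?_
  have ha' : ∀ᵐ x ∂(κ a), A x = a := ha
  filter_upwards [ha'] with x hx
  have : (a, x) ∈ S ↔ (A x, x) ∈ S := by rw [hx]
  exact propext this

/-- Conditioning on `A` does not change the law of a variable independent of `A`. -/
lemma IsDisintegration.map_eq_of_indepFun [IsProbabilityMeasure μ] (h : IsDisintegration κ μ A)
    (hA : Measurable A) [MeasurableSpace.CountablyGenerated ℛ] {ρ : 𝒳 → ℛ} (hρ : Measurable ρ)
    (hind : IndepFun A ρ μ) : ∀ᵐ a ∂(μ.map A), (κ a).map ρ = μ.map ρ := by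
  have := h.isMarkov
  have := Measure.isProbabilityMeasure_map (μ := μ) hA.aemeasurable
  have := Measure.isProbabilityMeasure_map (μ := μ) hρ.aemeasurable
  have := Kernel.IsMarkovKernel.map κ hρ
  have key : μ.map A ⊗ₘ (κ.map ρ) = μ.map A ⊗ₘ (Kernel.const 𝒜 (μ.map ρ)) := by
    rw [Measure.compProd_map hρ, h.compProd_eq hA, Measure.map_map (by fun_prop) (by fun_prop),
      Measure.compProd_const]
    exact (indepFun_iff_map_prod_eq_prod_map_map hA.aemeasurable hρ.aemeasurable).1 hind
  filter_upwards [Kernel.ae_eq_of_compProd_eq key] with a ha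
  rw [← Kernel.map_apply _ hρ, ha, Kernel.const_apply]

end Disintegration

/-- The space of real-valued functions that are measurable for a given `σ`-algebra. -/
def measurableFunctions {α : Type*} (𝓜 : MeasurableSpace α) : Submodule ℝ (α → ℝ) where
  carrier := {f | Measurable[𝓜] f}
  add_mem' hf hg := Measurable.add hf hg
  zero_mem' := measurable_const
  smul_mem' c _ hf := Measurable.const_smul hf c

lemma isSeqClosed_measurableFunctions {α : Type*} (𝓜 : MeasurableSpace α) :
    IsSeqClosed (measurableFunctions 𝓜 : Set (α → ℝ)) := fun _ _ hg hgf =>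
  measurable_of_tendsto_metrizable hg hgf

/-! ### The prior and its derivatives -/

namespace Discretisation

variable {d m N : ℕ} {Ω : Set (EuclideanSpace ℝ (Fin d))} {F : Type*} [NormedAddCommGroup F]
  [NormedSpace ℝ F] [MeasurableSpace F] {S : SmoothFunctionSpace Ω m F} {μ : Measure F}
  {k : EuclideanSpace ℝ (Fin d) → EuclideanSpace ℝ (Fin d) → ℝ} {γ : ℝ}
  {X : Fin (N + 1) → EuclideanSpace ℝ (Fin d)} {z z' : EuclideanSpace ℝ (Fin d)}

/-- The functionals in the Gaussian space of the point evaluations on `Ω`. -/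
noncomputable abbrev evalSpace (S : SmoothFunctionSpace Ω m F) (μ : Measure F) :
    Submodule ℝ (F → ℝ) :=
  gaussianSpace (fun (z : Ω) (f : F) => S.toFun f z) μ

section Prior

variable (hμ : IsGPPrior S (fun z z' => γ ^ 2 * k z z') μ)

include hμ

lemma isSeqClosed_evalSpace : IsSeqClosed (evalSpace S μ : Set (F → ℝ)) :=
  isSeqClosed_gaussianSpace hμ.1 hμ.2.1

lemma eval_mem (hz : z ∈ Ω) : (fun u => S.toFun u z) ∈ evalSpace S μ :=
  mem_gaussianSpace hμ.1 ⟨z, hz⟩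

lemma covariance_eq_integral {f g : F → ℝ} (hf : f ∈ evalSpace S μ) (hg : g ∈ evalSpace S μ) :
    cov[f, g; μ] = ∫ u, f u * g u ∂μ := by
  have := hμ.1.isProbabilityMeasure
  rw [covariance_eq_sub hf.1 hg.1, integral_eq_zero_of_mem_gaussianSpace hμ.1 hμ.2.1 hf]
  simp

lemma integral_eval_mul_eval (hz : z ∈ Ω) (hz' : z' ∈ Ω) :
    ∫ u, S.toFun u z * S.toFun u z' ∂μ = γ ^ 2 * k z z' := by
  rw [← covariance_eq_integral hμ (eval_mem hμ hz) (eval_mem hμ hz')]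
  exact hμ.2.2 ⟨z, hz⟩ ⟨z', hz'⟩

lemma kernel_comm (hγ : 0 < γ) (hz : z ∈ Ω) (hz' : z' ∈ Ω) : k z z' = k z' z := by
  have h1 := integral_eval_mul_eval hμ hz hz'
  have h2 := integral_eval_mul_eval hμ hz' hz
  simp_rw [mul_comm (S.toFun _ z')] at h2
  exact mul_left_cancel₀ (by positivity) (h1.symm.trans h2)

lemma kernel_eq_integral (hγ : 0 < γ) (hz : z ∈ Ω) (hz' : z' ∈ Ω) :
    k z z' = (∫ u, S.toFun u z * S.toFun u z' ∂μ) * (γ ^ 2)⁻¹ := by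
  rw [integral_eval_mul_eval hμ hz hz']
  field_simp

variable (𝒟 : LinDiffOp d m) (hΩ : UniqueDiffOn ℝ Ω) (hγ : 0 < γ)

include hΩ

lemma app_mem (hz : z ∈ Ω) : (fun u => 𝒟.app Ω (S.toFun u) z) ∈ evalSpace S μ :=
  𝒟.app_mem_of_isSeqClosed (isSeqClosed_evalSpace hμ) hΩ (fun _ hy => eval_mem hμ hy)
    S.contDiffOn hz

lemma contDiffOn_integral_eval_mul {ξ : F → ℝ} (hξ : ξ ∈ evalSpace S μ) :
    ContDiffOn ℝ m (fun y => ∫ u, S.toFun u y * ξ u ∂μ) Ω :=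
  (isLimitIntegrable_gaussianSpace hμ.1 hμ.2.1 hξ.1 _).contDiffOn_integral
    (isSeqClosed_evalSpace hμ) hΩ (fun _ hy => eval_mem hμ hy) S.contDiffOn

lemma app_integral_eval_mul {ξ : F → ℝ} (hξ : ξ ∈ evalSpace S μ) (hz : z ∈ Ω) :
    𝒟.app Ω (fun y => ∫ u, S.toFun u y * ξ u ∂μ) z = ∫ u, 𝒟.app Ω (S.toFun u) z * ξ u ∂μ :=
  𝒟.app_integral (isLimitIntegrable_gaussianSpace hμ.1 hμ.2.1 hξ.1 _)
    (isSeqClosed_evalSpace hμ) hΩ (fun _ hy => eval_mem hμ hy) S.contDiffOn hz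

include hγ

lemma contDiffOn_kernel (hz' : z' ∈ Ω) : ContDiffOn ℝ m (fun y => k y z') Ω :=
  ((contDiffOn_integral_eval_mul hμ hΩ (eval_mem hμ hz')).mul contDiffOn_const).congr
    fun _ hy => kernel_eq_integral hμ hγ hy hz'

/-- `𝒟 k` is the cross-covariance of `𝒟 u` and `u`, up to the factor `γ²`. -/
lemma kerFst_eq_integral (hz : z ∈ Ω) (hz' : z' ∈ Ω) :
    𝒟.kerFst Ω k z z' = (∫ u, 𝒟.app Ω (S.toFun u) z * S.toFun u z' ∂μ) * (γ ^ 2)⁻¹ := by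
  rw [← app_integral_eval_mul hμ 𝒟 hΩ (eval_mem hμ hz') hz,
    ← 𝒟.app_mul_const hΩ (contDiffOn_integral_eval_mul hμ hΩ (eval_mem hμ hz')) hz]
  exact 𝒟.app_congr (fun y hy => kernel_eq_integral hμ hγ hy hz') hz

lemma kerSnd_eq_integral (hz : z ∈ Ω) (hz' : z' ∈ Ω) :
    𝒟.kerSnd Ω k z z' = (∫ u, S.toFun u z * 𝒟.app Ω (S.toFun u) z' ∂μ) * (γ ^ 2)⁻¹ := by
  have : 𝒟.kerSnd Ω k z z' = 𝒟.kerFst Ω k z' z :=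
    𝒟.app_congr (fun y hy => kernel_comm hμ hγ hz hy) hz'
  simp_rw [this, kerFst_eq_integral hμ 𝒟 hΩ hγ hz' hz, mul_comm]

/-- `𝒟 𝒟* k` is the covariance of `𝒟 u`, up to the factor `γ²`. -/
lemma kerBoth_eq_integral (hz : z ∈ Ω) (hz' : z' ∈ Ω) :
    𝒟.kerBoth Ω k z z' =
      (∫ u, 𝒟.app Ω (S.toFun u) z * 𝒟.app Ω (S.toFun u) z' ∂μ) * (γ ^ 2)⁻¹ := by
  have hm := app_mem hμ 𝒟 hΩ hz'
  rw [← app_integral_eval_mul hμ 𝒟 hΩ hm hz,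
    ← 𝒟.app_mul_const hΩ (contDiffOn_integral_eval_mul hμ hΩ hm) hz]
  exact 𝒟.app_congr (fun y hy => kerSnd_eq_integral hμ 𝒟 hΩ hγ hy hz') hz

end Prior

/-! ### The residual of the regression on the grid values -/

/-- The regression weights `k(y, 𝕏) k(𝕏, 𝕏)⁻¹` for the value at `y` given the values on the
grid. -/
noncomputable def regressionWeight
    (k : EuclideanSpace ℝ (Fin d) → EuclideanSpace ℝ (Fin d) → ℝ)
    (X : Fin (N + 1) → EuclideanSpace ℝ (Fin d)) (y : EuclideanSpace ℝ (Fin d)) :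
    Fin (N + 1) → ℝ :=
  Matrix.vecMul (fun i => k y (X i)) (kerMatrix k X)⁻¹

/-- The residual function `y ↦ u(y) - k(y, 𝕏) k(𝕏, 𝕏)⁻¹ u(𝕏)`. -/
noncomputable def residual (S : SmoothFunctionSpace Ω m F)
    (k : EuclideanSpace ℝ (Fin d) → EuclideanSpace ℝ (Fin d) → ℝ)
    (X : Fin (N + 1) → EuclideanSpace ℝ (Fin d)) (u : F) (y : EuclideanSpace ℝ (Fin d)) : ℝ :=
  S.toFun u y - ∑ i, regressionWeight k X y i * S.toFun u (X i)

section Residual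

lemma smul_errMatrix_eq (𝒟 : LinDiffOp d m) :
    γ ^ 2 • errMatrix 𝒟 Ω k X = fun i j => γ ^ 2 * errKernel 𝒟 Ω k X (X i) (X j) := by
  ext i j
  simp [errMatrix_apply]

variable (hμ : IsGPPrior S (fun z z' => γ ^ 2 * k z z') μ) (hXΩ : ∀ i, X i ∈ Ω)

include hμ hXΩ

lemma residual_mem (hz : z ∈ Ω) : (fun u => residual S k X u z) ∈ evalSpace S μ := by
  have : (fun u => residual S k X u z) = (fun u => S.toFun u z) -
      ∑ i, regressionWeight k X z i • fun u => S.toFun u (X i) := by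
    ext u
    simp [residual]
  rw [this]
  exact Submodule.sub_mem _ (eval_mem hμ hz)
    (Submodule.sum_mem _ fun i _ => Submodule.smul_mem _ _ (eval_mem hμ (hXΩ i)))

lemma integral_residual_mul_eval (hX : IsUnit (kerMatrix k X)) (hz : z ∈ Ω) (j : Fin (N + 1)) :
    ∫ u, residual S k X u z * S.toFun u (X j) ∂μ = 0 := by
  have hint {f g : F → ℝ} (hf : f ∈ evalSpace S μ) (hg : g ∈ evalSpace S μ) :
      Integrable (fun u => f u * g u) μ := hf.1.integrable_mul hg.1
  have hE (i : Fin (N + 1)) : Integrable (fun u => regressionWeight k X z i *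
      (S.toFun u (X i) * S.toFun u (X j))) μ :=
    (hint (eval_mem hμ (hXΩ i)) (eval_mem hμ (hXΩ j))).const_mul _
  simp only [residual, sub_mul, Finset.sum_mul, mul_assoc]
  rw [integral_sub (hint (eval_mem hμ hz) (eval_mem hμ (hXΩ j)))
    (integrable_finsetSum _ fun i _ => hE i), integral_finsetSum _ fun i _ => hE i]
  simp only [integral_const_mul, integral_eval_mul_eval hμ (hXΩ _) (hXΩ j),
    integral_eval_mul_eval hμ hz (hXΩ j)]
  have h : Matrix.vecMul (regressionWeight k X z) (kerMatrix k X) = fun i => k z (X i) := by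
    rw [regressionWeight, Matrix.vecMul_vecMul,
      Matrix.nonsing_inv_mul _ ((Matrix.isUnit_iff_isUnit_det _).1 hX), Matrix.vecMul_one]
  rw [← congrFun h j, Matrix.vecMul, dotProduct, Finset.mul_sum, sub_eq_zero]
  refine Finset.sum_congr rfl fun i _ => ?_
  rw [kerMatrix, Matrix.of_apply]
  ring

variable (𝒟 : LinDiffOp d m) (hΩ : UniqueDiffOn ℝ Ω) (hγ : 0 < γ)

include hΩ hγ

lemma contDiffOn_regressionWeight (i : Fin (N + 1)) :
    ContDiffOn ℝ m (fun y => regressionWeight k X y i) Ω := by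
  simp only [regressionWeight, Matrix.vecMul, dotProduct]
  exact ContDiffOn.sum fun j _ => (contDiffOn_kernel hμ hΩ hγ (hXΩ j)).mul contDiffOn_const

lemma app_regressionWeight (hz : z ∈ Ω) (i : Fin (N + 1)) :
    𝒟.app Ω (fun y => regressionWeight k X y i) z = weight 𝒟 Ω k X z i := by
  have hk (j : Fin (N + 1)) := contDiffOn_kernel hμ hΩ hγ (hXΩ j)
  simp only [regressionWeight, weight, Matrix.vecMul, dotProduct]
  rw [𝒟.app_sum hΩ _ (fun j _ => (hk j).mul contDiffOn_const) hz]
  exact Finset.sum_congr rfl fun j _ => 𝒟.app_mul_const hΩ (hk j) hz _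

lemma contDiffOn_residual (u : F) : ContDiffOn ℝ m (residual S k X u) Ω :=
  (S.contDiffOn u).sub
    (ContDiffOn.sum fun i _ => (contDiffOn_regressionWeight hμ hXΩ hΩ hγ i).mul contDiffOn_const)

/-- Applying `𝒟` to the residual turns the regression weights into `W`. -/
lemma app_residual (hz : z ∈ Ω) (u : F) :
    𝒟.app Ω (residual S k X u) z =
      𝒟.app Ω (S.toFun u) z - ∑ i, weight 𝒟 Ω k X z i * S.toFun u (X i) := by
  have hw (i : Fin (N + 1)) := contDiffOn_regressionWeight hμ hXΩ hΩ hγ i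
  have hs : ContDiffOn ℝ m
      (fun y => ∑ i, regressionWeight k X y i * S.toFun u (X i)) Ω :=
    ContDiffOn.sum fun i _ => (hw i).mul contDiffOn_const
  have h := 𝒟.app_sub hΩ (S.contDiffOn u) hs hz
  rw [𝒟.app_sum hΩ _ (fun i _ => (hw i).mul contDiffOn_const) hz] at h
  refine h.trans ?_
  congr 1
  refine Finset.sum_congr rfl fun i _ => ?_
  rw [𝒟.app_mul_const hΩ (hw i) hz, app_regressionWeight hμ hXΩ 𝒟 hΩ hγ hz]

lemma app_residual_mem (hz : z ∈ Ω) :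
    (fun u => 𝒟.app Ω (residual S k X u) z) ∈ evalSpace S μ :=
  𝒟.app_mem_of_isSeqClosed (isSeqClosed_evalSpace hμ) hΩ (fun _ hy => residual_mem hμ hXΩ hy)
    (contDiffOn_residual hμ hXΩ hΩ hγ) hz

lemma integral_app_residual_mul_eval (hX : IsUnit (kerMatrix k X)) (hz : z ∈ Ω)
    (j : Fin (N + 1)) : ∫ u, 𝒟.app Ω (residual S k X u) z * S.toFun u (X j) ∂μ = 0 := by
  rw [← 𝒟.app_integral (isLimitIntegrable_gaussianSpace hμ.1 hμ.2.1 (eval_mem hμ (hXΩ j)).1 _)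
    (isSeqClosed_evalSpace hμ) hΩ (fun _ hy => residual_mem hμ hXΩ hy)
    (contDiffOn_residual hμ hXΩ hΩ hγ) hz]
  rw [𝒟.app_congr (g := fun y => (fun _ => (0 : ℝ)) y * 0)
    (fun y hy => by simp [integral_residual_mul_eval hμ hXΩ hX hy j]) hz,
    𝒟.app_mul_const hΩ contDiffOn_const hz, mul_zero]

lemma integral_app_residual_mul_app_residual (hX : IsUnit (kerMatrix k X)) (hz : z ∈ Ω)
    (hz' : z' ∈ Ω) :
    ∫ u, 𝒟.app Ω (residual S k X u) z * 𝒟.app Ω (residual S k X u) z' ∂μ =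
      γ ^ 2 * errKernel 𝒟 Ω k X z z' := by
  have hint {f g : F → ℝ} (hf : f ∈ evalSpace S μ) (hg : g ∈ evalSpace S μ) :
      Integrable (fun u => f u * g u) μ := hf.1.integrable_mul hg.1
  have hγ2 : γ ^ 2 ≠ 0 := by positivity
  have hR := app_residual_mem hμ hXΩ 𝒟 hΩ hγ hz
  have hD := app_mem hμ 𝒟 hΩ hz'
  -- The residual at `z` is orthogonal to the grid values, so only `𝒟 u` counts at `z'`.
  have h1 : ∫ u, 𝒟.app Ω (residual S k X u) z * 𝒟.app Ω (residual S k X u) z' ∂μ =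
      ∫ u, 𝒟.app Ω (residual S k X u) z * 𝒟.app Ω (S.toFun u) z' ∂μ := by
    have hE (i : Fin (N + 1)) : Integrable (fun u => weight 𝒟 Ω k X z' i *
        (𝒟.app Ω (residual S k X u) z * S.toFun u (X i))) μ :=
      (hint hR (eval_mem hμ (hXΩ i))).const_mul _
    have he (u : F) : 𝒟.app Ω (residual S k X u) z * 𝒟.app Ω (residual S k X u) z' =
        𝒟.app Ω (residual S k X u) z * 𝒟.app Ω (S.toFun u) z' -
          ∑ i, weight 𝒟 Ω k X z' i * (𝒟.app Ω (residual S k X u) z * S.toFun u (X i)) := by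
      rw [app_residual hμ hXΩ 𝒟 hΩ hγ hz', mul_sub, Finset.mul_sum]
      congr 1
      exact Finset.sum_congr rfl fun i _ => by ring
    simp_rw [he]
    rw [integral_sub (hint hR hD) (integrable_finsetSum _ fun i _ => hE i),
      integral_finsetSum _ fun i _ => hE i]
    simp [integral_const_mul, integral_app_residual_mul_eval hμ hXΩ 𝒟 hΩ hγ hX hz]
  have h2 : ∫ u, 𝒟.app Ω (residual S k X u) z * 𝒟.app Ω (S.toFun u) z' ∂μ =
      γ ^ 2 * (𝒟.kerBoth Ω k z z' - ∑ i, weight 𝒟 Ω k X z i * 𝒟.kerFst Ω k z' (X i)) := by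
    have hE (i : Fin (N + 1)) : Integrable (fun u => weight 𝒟 Ω k X z i *
        (𝒟.app Ω (S.toFun u) z' * S.toFun u (X i))) μ :=
      (hint hD (eval_mem hμ (hXΩ i))).const_mul _
    have he (u : F) : 𝒟.app Ω (residual S k X u) z * 𝒟.app Ω (S.toFun u) z' =
        𝒟.app Ω (S.toFun u) z * 𝒟.app Ω (S.toFun u) z' -
          ∑ i, weight 𝒟 Ω k X z i * (𝒟.app Ω (S.toFun u) z' * S.toFun u (X i)) := by
      rw [app_residual hμ hXΩ 𝒟 hΩ hγ hz, sub_mul, Finset.sum_mul]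
      congr 1
      exact Finset.sum_congr rfl fun i _ => by ring
    simp_rw [he]
    rw [integral_sub (hint (app_mem hμ 𝒟 hΩ hz) hD) (integrable_finsetSum _ fun i _ => hE i),
      integral_finsetSum _ fun i _ => hE i, kerBoth_eq_integral hμ 𝒟 hΩ hγ hz hz', mul_sub,
      Finset.mul_sum]
    congr 1
    · field_simp
    · refine Finset.sum_congr rfl fun i _ => ?_
      rw [integral_const_mul, kerFst_eq_integral hμ 𝒟 hΩ hγ hz' (hXΩ i)]
      field_simp
  have h3 : Matrix.mulVec (kerMatrix k X) (weight 𝒟 Ω k X z') =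
      fun i => 𝒟.kerFst Ω k z' (X i) := by
    have hsymm : (kerMatrix k X).transpose = kerMatrix k X := by
      ext i j
      exact kernel_comm hμ hγ (hXΩ j) (hXΩ i)
    rw [← hsymm, Matrix.mulVec_transpose, weight, Matrix.vecMul_vecMul,
      Matrix.nonsing_inv_mul _ ((Matrix.isUnit_iff_isUnit_det _).1 hX), Matrix.vecMul_one]
  rw [h1, h2, errKernel, h3]
  rfl

/-- Under the prior, `𝒟` applied to the residual is the centred Gaussian process with
covariance `γ² k̂`. -/
lemma isGPWith_app_residual (hX : IsUnit (kerMatrix k X)) :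
    IsGPWith (fun (z : Ω) (u : F) => 𝒟.app Ω (residual S k X u) z) (fun _ => 0)
      (fun z z' => γ ^ 2 * errKernel 𝒟 Ω k X z z') μ := by
  have hm (z : Ω) := app_residual_mem hμ hXΩ 𝒟 hΩ hγ z.2
  refine ⟨isGaussianProcess_of_mem_gaussianSpace hμ.1 hμ.2.1 hm, fun z =>
    integral_eq_zero_of_mem_gaussianSpace hμ.1 hμ.2.1 (hm z), fun z z' => ?_⟩
  rw [covariance_eq_integral hμ (hm z) (hm z')]
  exact integral_app_residual_mul_app_residual hμ hXΩ 𝒟 hΩ hγ hX z.2 z'.2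

lemma posSemidef_errMatrix (hX : IsUnit (kerMatrix k X)) : (errMatrix 𝒟 Ω k X).PosSemidef := by
  have h : (γ ^ 2 • errMatrix 𝒟 Ω k X).PosSemidef := by
    rw [smul_errMatrix_eq]
    exact ((isGPWith_app_residual hμ hXΩ 𝒟 hΩ hγ hX).comp_right
      fun i => (⟨X i, hXΩ i⟩ : Ω)).posSemidef
  have h2 := h.smul (a := (γ ^ 2)⁻¹) (by positivity)
  rwa [inv_smul_smul₀ (by positivity)] at h2

omit hΩ hγ in
/-- The residual and the grid values are jointly Gaussian and uncorrelated. -/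
lemma indepFun_residual (hX : IsUnit (kerMatrix k X)) {D : Set Ω} :
    IndepFun (fun u i => S.toFun u (X i)) (fun u (z : D) => residual S k X u z) μ := by
  have hE (i : Fin (N + 1)) := eval_mem hμ (hXΩ i)
  have hR (z : D) := residual_mem (k := k) hμ hXΩ z.1.2
  have hm : ∀ t, Sum.elim (fun i u => S.toFun u (X i)) (fun (z : D) u => residual S k X u z) t ∈
      evalSpace S μ := by
    rintro (i | z)
    exacts [hE i, hR z]
  refine (isGaussianProcess_of_mem_gaussianSpace hμ.1 hμ.2.1 hm).indepFun_of_covariance_eq_zero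
    (fun i => (hE i).1.aestronglyMeasurable.aemeasurable)
    (fun z => (hR z).1.aestronglyMeasurable.aemeasurable) fun i z => ?_
  rw [covariance_comm, covariance_eq_integral hμ (hR z) (hE i)]
  exact integral_residual_mul_eval hμ hXΩ hX z.1.2 i

/-- If `D` is dense in `Ω`, then `𝒟` applied to the residual is a measurable function of the
values of the residual on `D`. -/
lemma measurable_comap_app_residual {D : Set Ω} (hD : Dense D) (hz : z ∈ Ω) :
    Measurable[MeasurableSpace.comap (fun (u : F) (z : D) => residual S k X u z) inferInstance]
      (fun u => 𝒟.app Ω (residual S k X u) z) := by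
  refine 𝒟.app_mem_of_isSeqClosed (isSeqClosed_measurableFunctions _) hΩ (fun y hy => ?_)
    (contDiffOn_residual hμ hXΩ hΩ hγ) hz
  obtain ⟨w, hw, hwy⟩ := mem_closure_iff_seq_limit.1 (hD ⟨y, hy⟩)
  refine isSeqClosed_measurableFunctions _ (x := fun n u => residual S k X u (w n))
    (fun n => ?_) (tendsto_pi_nhds.2 fun u => ?_)
  · exact (measurable_pi_apply (X := fun _ : D => ℝ) ⟨w n, hw n⟩).comp (comap_measurable _)
  · have hc := (contDiffOn_residual hμ hXΩ hΩ hγ u).continuousOn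
    exact (continuousOn_iff_continuous_domRestrict.1 hc).continuousAt.tendsto.comp hwy

end Residual

/-! ### Conditioning on the grid values -/

section Conditioning

variable [BorelSpace F] (hμ : IsGPPrior S (fun z z' => γ ^ 2 * k z z') μ) (hXΩ : ∀ i, X i ∈ Ω)
  (𝒟 : LinDiffOp d m) (hΩ : UniqueDiffOn ℝ Ω) (hγ : 0 < γ)

lemma measurable_eval (S : SmoothFunctionSpace Ω m F) (hz : z ∈ Ω) :
    Measurable fun u => S.toFun u z :=
  (S.continuous_eval z hz).measurable

lemma measurable_info (S : SmoothFunctionSpace Ω m F) (hXΩ : ∀ i, X i ∈ Ω) :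
    Measurable fun u i => S.toFun u (X i) :=
  measurable_pi_lambda _ fun i => measurable_eval S (hXΩ i)

include hμ hXΩ hΩ hγ

/-- Given `u(𝕏) = a`, the function `𝒟 u` differs from `𝒟` of the residual by `W(·) a`, and
the residual keeps its law, being independent of `u(𝕏)`. -/
theorem isGPWith_app_of_isDisintegration (hX : IsUnit (kerMatrix k X))
    {κ : Kernel (Fin (N + 1) → ℝ) F} (hκ : IsDisintegration κ μ fun u i => S.toFun u (X i)) :
    ∀ᵐ a ∂(μ.map fun u i => S.toFun u (X i)),
      IsGPWith (fun (z : Ω) (u : F) => 𝒟.app Ω (S.toFun u) z)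
        (fun z => dotProduct (weight 𝒟 Ω k X z) a)
        (fun z z' => γ ^ 2 * errKernel 𝒟 Ω k X z z') (κ a) := by
  have := hμ.1.isProbabilityMeasure
  have hA := measurable_info S hXΩ
  -- A countable dense set keeps the exceptional null set independent of the point.
  obtain ⟨D, hDc, hD⟩ := TopologicalSpace.exists_countable_dense Ω
  have := hDc.to_subtype
  have hρ : Measurable fun (u : F) (z : D) => residual S k X u z :=
    measurable_pi_lambda _ fun z => (measurable_eval S z.1.2).sub
      (Finset.measurable_fun_sum _ fun i _ => (measurable_eval S (hXΩ i)).const_mul _)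
  filter_upwards [hκ.map_eq_of_indepFun hA hρ (indepFun_residual hμ hXΩ hX), hκ.concentrated]
    with a ha hconc
  have h := (isGPWith_app_residual hμ hXΩ 𝒟 hΩ hγ hX).of_map_eq hρ ha fun z =>
    measurable_comap_app_residual hμ hXΩ 𝒟 hΩ hγ hD z.2
  have hs := h.add_const fun z => dotProduct (weight 𝒟 Ω k X z) a
  simp only [zero_add] at hs
  have hconc' : ∀ᵐ u ∂(κ a), (fun i => S.toFun u (X i)) = a := hconc
  refine hs.congr fun z => ?_
  filter_upwards [hconc'] with u hu
  rw [app_residual hμ hXΩ 𝒟 hΩ hγ z.2, ← hu]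
  exact sub_add_cancel _ _

end Conditioning

end Discretisation

theorem mainTheorem1 {d m N : ℕ} (Ω : Set (EuclideanSpace ℝ (Fin d))) (hΩ : UniqueDiffOn ℝ Ω)
    {F : Type*} [NormedAddCommGroup F] [NormedSpace ℝ F] [CompleteSpace F]
    [TopologicalSpace.SeparableSpace F] [MeasurableSpace F] [BorelSpace F]
    (S : SmoothFunctionSpace Ω m F) (𝒟 : LinDiffOp d m)
    (k : EuclideanSpace ℝ (Fin d) → EuclideanSpace ℝ (Fin d) → ℝ) (γ : ℝ) (hγ : 0 < γ)
    (X : Fin (N + 1) → EuclideanSpace ℝ (Fin d)) (hXΩ : ∀ i, X i ∈ Ω)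
    (hX : IsUnit (Discretisation.kerMatrix k X)) :
    -- the discretisation is a Bayesian method for the quantity of interest `(𝒟 u)(𝕏)`
    (Discretisation.method S 𝒟 k γ X).IsBayesian (Discretisation.qoi S 𝒟 X) ∧
    -- `E` is a covariance matrix, and conditioning on `u(𝕏) = a` and then applying `𝒟` yields
    -- the process `GP(W(·) a, γ² k̂)` on all of `Ω`
    ∀ μ : Measure F, IsGPPrior S (fun z z' => γ ^ 2 * k z z') μ →
      (Discretisation.errMatrix 𝒟 Ω k X).PosSemidef ∧
      ∀ κ : Kernel (Fin (N + 1) → ℝ) F,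
        IsDisintegration κ μ (fun u i => S.toFun u (X i)) →
        ∀ᵐ a ∂(μ.map (fun u i => S.toFun u (X i))),
          IsGPWith (fun (z : Ω) (u : F) => 𝒟.app Ω (S.toFun u) z)
            (fun z => dotProduct (Discretisation.weight 𝒟 Ω k X z) a)
            (fun z z' => γ ^ 2 * Discretisation.errKernel 𝒟 Ω k X z z') (κ a) := by
  refine ⟨fun μ hμ => ?_, fun μ hμ =>
    ⟨Discretisation.posSemidef_errMatrix hμ hXΩ 𝒟 hΩ hγ hX, fun κ hκ =>
      Discretisation.isGPWith_app_of_isDisintegration hμ hXΩ 𝒟 hΩ hγ hX hκ⟩⟩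
  replace hμ : IsGPPrior S (fun z z' => γ ^ 2 * k z z') μ := hμ
  have := hμ.1.isProbabilityMeasure
  refine ⟨exists_isDisintegration (Discretisation.measurable_info S hXΩ), fun κ hκ => ?_⟩
  filter_upwards [Discretisation.isGPWith_app_of_isDisintegration hμ hXΩ 𝒟 hΩ hγ hX hκ] with a ha
  have h := (ha.comp_right fun i => (⟨X i, hXΩ i⟩ : Ω)).map_toLp
  rw [← Discretisation.smul_errMatrix_eq] at h
  exact h.symm
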